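/- Let $p$ be an odd prime number and let $\alpha\in\mathbb{C}$ be a cyclotomic integer, i.e. an element of the subring of $\mathbb{C}$ generated by all roots of unity. Let $\mathrm{house}(\alpha)$ denote the house of $\alpha$, that is, the maximum of $|\beta|$ over all conjugates $\beta\in\mathbb{C}$ of $\alpha$ over $\mathbb{Q}$. Call two algebraic numbers equivalent if one is a root of unity times a conjugate over $\mathbb{Q}$ of the other, and let the minimal level of $\alpha$ be the smallest positive integer $N$ such that $\alpha$ is equivalent to some element of $\mathbb{Q}(\zeta_N)$, where $\zeta_N=e^{2\pi i/N}$. If $\mathrm{house}(\alpha)^2=p^k$ for some integer $k\ge 0$, then the minimal level of $\alpha$ is not divisible by $p^2$. -/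

import Mathlib

namespace CyclotomicHouse

/-- `ζ` is a complex root of unity (of some order `n ≥ 1`). -/
def IsRootOfUnity (ζ : ℂ) : Prop := ∃ n : ℕ, 0 < n ∧ ζ ^ n = 1

/-- Cyclotomic integers: the elements of the subring of `ℂ` generated by all roots of unity. -/
def IsCyclotomicInteger (α : ℂ) : Prop := α ∈ Subring.closure {ζ : ℂ | IsRootOfUnity ζ}

/-- The house of an algebraic number `α`: the maximum of `|β|` over the conjugates `β` of `α`
in `ℂ`, i.e. over the complex roots of the minimal polynomial of `α` over `ℚ`. -/
noncomputable def house (α : ℂ) : ℝ := sSup (norm '' ((minpoly ℚ α).rootSet ℂ))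

/-- For an algebraic number the supremum defining the house is attained. -/
theorem isGreatest_house {α : ℂ} (hα : IsIntegral ℚ α) :
    IsGreatest (norm '' ((minpoly ℚ α).rootSet ℂ)) (house α) := by
  have hfin : (norm '' ((minpoly ℚ α).rootSet ℂ)).Finite :=
    ((minpoly ℚ α).rootSet_finite ℂ).image _
  have hne : (norm '' ((minpoly ℚ α).rootSet ℂ)).Nonempty :=
    ⟨‖α‖, α, (Polynomial.mem_rootSet).2 ⟨minpoly.ne_zero hα, minpoly.aeval ℚ α⟩, rfl⟩
  exact ⟨hne.csSup_mem hfin, fun x hx => le_csSup hfin.bddAbove hx⟩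

/-- `α` and `β` are equivalent if `β` is a root of unity times a conjugate of `α` over `ℚ`. -/
def Equivalent (α β : ℂ) : Prop :=
  ∃ ζ γ : ℂ, IsRootOfUnity ζ ∧ IsConjRoot ℚ α γ ∧ β = ζ * γ

/-- The root of unity `ζ_N = exp (2 π i / N)`. -/
noncomputable def zeta (N : ℕ) : ℂ := Complex.exp (2 * Real.pi * Complex.I / N)

/-- The minimal level of `α`: the smallest positive integer `N` such that `α` is equivalent to
some element of `ℚ(ζ_N)`. -/
noncomputable def minimalLevel (α : ℂ) : ℕ :=
  sInf {N : ℕ | 0 < N ∧ ∃ β ∈ IntermediateField.adjoin ℚ {zeta N}, Equivalent α β}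

end CyclotomicHouse

/-! In a cyclotomic field complex conjugation commutes with every embedding, so `|α|² = p^k` at one
conjugate gives it at all (`norm_sq_embedding_eq`), and `(α)` divides `(p^k)`. Automorphisms `ζ ↦
ωζ` with `ω` of `p`-power order are inert at `p`: they preserve each prime above `p`, hence `(α)`,
and by Kronecker they multiply `α` by a root of unity (`exists_root_of_unity_mul_of_inertia`). Let
`N = p^a M` with `p ∤ M` and `a ≥ 2`. Let `s` invert the `p`-power roots of unity and fix those of
order dividing `M`. Twisting `α` by a power of `ζ` removes the `p`-part of the square of its
`s`-multiplier. Comparing `sτ = τs` for `τ` fixing `ζ^p` then forces the `τ`-multiplier to be 1, so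
the twist lies in level `N / p` (`exists_mul_mem_adjoin_pow`), against minimality. -/

section CyclotomicField

open NumberField IntermediateField

variable {K : Type*} [Field K] [NumberField K] {N : ℕ} [NeZero N] [IsCyclotomicExtension {N} ℚ K]
  {ζ : K}

/-! ### Galois action and complex conjugation -/

theorem IsPrimitiveRoot.exists_algEquiv_apply_eq_pow (hζ : IsPrimitiveRoot ζ N) {c : ℕ}
    (hc : c.Coprime N) : ∃ σ : K ≃ₐ[ℚ] K, σ ζ = ζ ^ c := by
  have hirr := Polynomial.cyclotomic.irreducible_rat (NeZero.pos N)
  let f := IsCyclotomicExtension.fromZetaAut hζ hirr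
  let g := IsCyclotomicExtension.fromZetaAut (hζ.pow_of_coprime c hc) hirr
  refine ⟨f.symm.trans g, ?_⟩
  have hf : f (IsCyclotomicExtension.zeta N ℚ K) = ζ :=
    IsCyclotomicExtension.fromZetaAut_spec hζ hirr
  have hg : g (IsCyclotomicExtension.zeta N ℚ K) = ζ ^ c :=
    IsCyclotomicExtension.fromZetaAut_spec (hζ.pow_of_coprime c hc) hirr
  rw [AlgEquiv.trans_apply, ← hg]
  congr 1
  rw [AlgEquiv.symm_apply_eq, hf]

theorem IsPrimitiveRoot.algHom_ext_of_cyclotomic {A : Type*} [CommRing A] [Algebra ℚ A]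
    (hζ : IsPrimitiveRoot ζ N) {f g : K →ₐ[ℚ] A} (h : f ζ = g ζ) : f = g :=
  (hζ.powerBasis ℚ).algHom_ext (by simpa using h)

/-- Conjugation inverts roots of unity under every embedding, so one `c` serves all `φ`. -/
theorem exists_algEquiv_star_comm (N : ℕ) [NeZero N] [IsCyclotomicExtension {N} ℚ K] :
    ∃ c : K ≃ₐ[ℚ] K, ∀ (φ : K →+* ℂ) (x : K), φ (c x) = star (φ x) := by
  have hζ := IsCyclotomicExtension.zeta_spec N ℚ K
  have hcop : (N - 1).Coprime N := by
    have := Nat.coprime_self_sub_right (m := 1) (n := N) (NeZero.one_le)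
    rw [Nat.coprime_comm]
    exact this.2 (by simp)
  obtain ⟨c, hc⟩ := hζ.exists_algEquiv_apply_eq_pow hcop
  refine ⟨c, fun φ x => ?_⟩
  let f : K →ₐ[ℚ] ℂ := φ.toRatAlgHom.comp c.toAlgHom
  let g : K →ₐ[ℚ] ℂ := ((starRingEnd ℂ).comp φ).toRatAlgHom
  have hfg : f = g := by
    refine hζ.algHom_ext_of_cyclotomic ?_
    change φ (c _) = starRingEnd ℂ (φ _)
    have h1 : φ (IsCyclotomicExtension.zeta N ℚ K) ^ N = 1 := by
      rw [← map_pow, hζ.pow_eq_one, map_one]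
    have h2 := Complex.norm_eq_one_of_pow_eq_one h1 (NeZero.ne N)
    rw [hc, map_pow, ← Complex.inv_eq_conj h2]
    refine eq_inv_of_mul_eq_one_left ?_
    rw [← pow_succ, Nat.sub_add_cancel NeZero.one_le, h1]
  exact DFunLike.congr_fun hfg x

theorem algEquiv_mul_self_eq_of_norm_sq {c : K ≃ₐ[ℚ] K}
    (hc : ∀ (φ : K →+* ℂ) (x : K), φ (c x) = star (φ x)) {x : K} {q : ℕ} {φ : K →+* ℂ}
    (h : ‖φ x‖ ^ 2 = q) : c x * x = q := by
  apply φ.injective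
  rw [map_mul, hc, map_natCast]
  change starRingEnd ℂ _ * _ = _
  rw [Complex.conj_mul']
  exact_mod_cast h

/-- The relation `c x * x = q` holds in `K` itself, so every embedding transports it. -/
theorem norm_sq_embedding_eq (N : ℕ) [NeZero N] [IsCyclotomicExtension {N} ℚ K] {x : K} {q : ℕ}
    {φ : K →+* ℂ} (h : ‖φ x‖ ^ 2 = q) (ψ : K →+* ℂ) : ‖ψ x‖ ^ 2 = q := by
  obtain ⟨c, hc⟩ := exists_algEquiv_star_comm (K := K) N
  have h1 := congrArg ψ (algEquiv_mul_self_eq_of_norm_sq hc h)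
  rw [map_mul, hc, map_natCast] at h1
  change starRingEnd ℂ _ * _ = _ at h1
  rw [Complex.conj_mul'] at h1
  exact_mod_cast h1

/-! ### Inertia at `p` -/

theorem sub_mem_of_inertia (hζ : IsPrimitiveRoot ζ N) {p b : ℕ} (hp : p.Prime) {σ : K ≃ₐ[ℚ] K}
    {ω : K} (hω : ω ^ p ^ b = 1) (hσ : σ ζ = ω * ζ) {P : Ideal (𝓞 K)} [P.IsPrime]
    (hpP : (p : 𝓞 K) ∈ P) (x : 𝓞 K) : RingOfIntegers.mapRingHom (σ : K →+* K) x - x ∈ P := by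
  have hζi : IsIntegral ℤ ζ := hζ.isIntegral (NeZero.pos N)
  have hωi : IsIntegral ℤ ω :=
    IsIntegral.of_pow (pow_pos hp.pos b) (by rw [hω]; exact isIntegral_one)
  let z : 𝓞 K := ⟨ζ, hζi⟩
  let w : 𝓞 K := ⟨ω, hωi⟩
  have hw : w ^ p ^ b = 1 := RingOfIntegers.ext (by
    change ω ^ p ^ b = 1
    exact hω)
  -- Modulo `p`, `(w - 1) ^ p ^ b` is `w ^ p ^ b - 1 = 0`.
  have hwP : w - 1 ∈ P := by
    refine Ideal.IsPrime.mem_of_pow_mem ‹_› (p ^ b) ?_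
    obtain ⟨r, hr⟩ := exists_add_pow_prime_pow_eq hp (w - 1) 1 b
    rw [sub_add_cancel, hw, one_pow] at hr
    have : (w - 1) ^ p ^ b = -((p : 𝓞 K) * ((w - 1) * 1 * r)) := by linear_combination -hr
    rw [this]
    exact P.neg_mem (P.mul_mem_right _ hpP)
  have hx : (x : K) ∈ Algebra.adjoin ℤ {ζ} := by
    have := IsCyclotomicExtension.Rat.isIntegralClosure_adjoin_singleton hζ
    obtain ⟨y, hy⟩ := (IsIntegralClosure.isIntegral_iff (A := Algebra.adjoin ℤ {ζ})
      (R := ℤ)).1 x.isIntegral_coe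
    change algebraMap (𝓞 K) K x ∈ _
    rw [← hy]
    exact y.2
  have key : ∀ y ∈ Algebra.adjoin ℤ {ζ}, ∃ z : 𝓞 K, (z : K) = y ∧
      RingOfIntegers.mapRingHom (σ : K →+* K) z - z ∈ P := by
    intro y hy
    induction hy using Algebra.adjoin_induction with
    | mem y hy =>
      rw [Set.mem_singleton_iff] at hy
      subst hy
      refine ⟨z, rfl, ?_⟩
      have : RingOfIntegers.mapRingHom (σ : K →+* K) z - z = (w - 1) * z := by
        apply RingOfIntegers.ext
        change σ y - y = (ω - 1) * y
        rw [hσ]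
        ring
      rw [this]
      exact P.mul_mem_right _ hwP
    | algebraMap r => exact ⟨algebraMap ℤ _ r, by simp, by simp⟩
    | add y₁ y₂ _ _ h₁ h₂ =>
      obtain ⟨z₁, rfl, h₁⟩ := h₁
      obtain ⟨z₂, rfl, h₂⟩ := h₂
      refine ⟨z₁ + z₂, by simp, ?_⟩
      rw [map_add, add_sub_add_comm]
      exact P.add_mem h₁ h₂
    | mul y₁ y₂ _ _ h₁ h₂ =>
      obtain ⟨z₁, rfl, h₁⟩ := h₁
      obtain ⟨z₂, rfl, h₂⟩ := h₂
      refine ⟨z₁ * z₂, by simp, ?_⟩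
      have : RingOfIntegers.mapRingHom (σ : K →+* K) (z₁ * z₂) - z₁ * z₂ =
          (RingOfIntegers.mapRingHom (σ : K →+* K) z₁ - z₁) *
            RingOfIntegers.mapRingHom (σ : K →+* K) z₂ +
          z₁ * (RingOfIntegers.mapRingHom (σ : K →+* K) z₂ - z₂) := by
        rw [map_mul]
        ring
      rw [this]
      exact P.add_mem (P.mul_mem_right _ h₁) (P.mul_mem_left _ h₂)
  obtain ⟨y, hy, hyP⟩ := key x hx
  rwa [← RingOfIntegers.ext hy]

theorem map_le_of_dvd_prime_pow (hζ : IsPrimitiveRoot ζ N) {p b : ℕ} (hp : p.Prime)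
    {σ : K ≃ₐ[ℚ] K} {ω : K} (hω : ω ^ p ^ b = 1) (hσ : σ ζ = ω * ζ) {k : ℕ} (I : Ideal (𝓞 K))
    (hI : I ∣ Ideal.span {(p : 𝓞 K) ^ k}) :
    I.map (RingOfIntegers.mapRingHom (σ : K →+* K)) ≤ I := by
  induction I using UniqueFactorizationMonoid.induction_on_prime with
  | h₁ => simp [Ideal.map_bot]
  | h₂ I hu =>
    rw [Ideal.isUnit_iff.1 hu]
    exact le_top
  | h₃ I P hI0 hP ih =>
    rw [Ideal.map_mul]
    refine Ideal.mul_mono ?_ (ih ((dvd_mul_left I P).trans hI))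
    have hPp : P.IsPrime := Ideal.isPrime_of_prime hP
    have hpP : (p : 𝓞 K) ∈ P := by
      have h := Ideal.dvd_iff_le.1 ((dvd_mul_right P I).trans hI)
      exact hPp.mem_of_pow_mem k (h (Ideal.mem_span_singleton_self _))
    rw [Ideal.map_le_iff_le_comap]
    intro x hx
    rw [Ideal.mem_comap]
    have := P.add_mem (sub_mem_of_inertia hζ hp hω hσ hpP x) hx
    rwa [sub_add_cancel] at this

/-- Ideal inclusion makes `ε` integral; its absolute values are all 1, so Kronecker applies. The
exponent is `2 * N` because `-1` need not be a power of `ζ`. -/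
theorem exists_root_of_unity_mul_of_inertia (hζ : IsPrimitiveRoot ζ N) {p b k : ℕ}
    (hp : p.Prime) {σ : K ≃ₐ[ℚ] K} {ω : K} (hω : ω ^ p ^ b = 1) (hσ : σ ζ = ω * ζ) {x : K}
    (hx : IsIntegral ℤ x) (hxn : ∀ φ : K →+* ℂ, ‖φ x‖ ^ 2 = (p ^ k : ℕ)) :
    ∃ ε : K, ε ^ (2 * N) = 1 ∧ σ x = ε * x := by
  obtain ⟨c, hc⟩ := exists_algEquiv_star_comm (K := K) N
  obtain ⟨φ₀⟩ : Nonempty (K →+* ℂ) := inferInstance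
  have hcx := algEquiv_mul_self_eq_of_norm_sq hc (hxn φ₀)
  let X : 𝓞 K := ⟨x, hx⟩
  have hdvd : X ∣ (p : 𝓞 K) ^ k := by
    refine ⟨RingOfIntegers.mapRingHom (c : K →+* K) X, RingOfIntegers.ext ?_⟩
    change algebraMap (𝓞 K) K ((p : 𝓞 K) ^ k) = x * c x
    rw [mul_comm, hcx, map_pow, map_natCast, Nat.cast_pow]
  have hmap := map_le_of_dvd_prime_pow hζ hp hω hσ (Ideal.span {X})
    (Ideal.dvd_iff_le.2 (Ideal.span_singleton_le_span_singleton.2 hdvd))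
  rw [Ideal.map_span, Set.image_singleton, Ideal.span_singleton_le_span_singleton] at hmap
  obtain ⟨ε, hε⟩ := hmap
  have hεx : σ x = ε * x := by
    have := congrArg (algebraMap (𝓞 K) K) hε
    rw [map_mul, mul_comm] at this
    exact this
  refine ⟨ε, ?_, hεx⟩
  have hnorm (φ : K →+* ℂ) : ‖φ ε‖ = 1 := by
    have h1 := hxn (φ.comp (σ : K →+* K))
    change ‖φ (σ x)‖ ^ 2 = _ at h1
    rw [hεx, map_mul, norm_mul, mul_pow, hxn φ] at h1
    have h2 : ((p ^ k : ℕ) : ℝ) ≠ 0 := by exact_mod_cast (pow_pos hp.pos k).ne'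
    have h3 : ‖φ ε‖ ^ 2 = 1 := mul_right_cancel₀ h2 (by rw [h1, one_mul])
    exact (pow_eq_one_iff_of_nonneg (norm_nonneg _) two_ne_zero).1 h3
  obtain ⟨n, hn, hεn⟩ := Embeddings.pow_eq_one_of_norm_eq_one K ℂ ε.isIntegral_coe hnorm
  have hfin : IsOfFinOrder (ε : K) := isOfFinOrder_iff_pow_eq_one.2 ⟨n, hn, hεn⟩
  have hd := (IsPrimitiveRoot.orderOf (ε : K)).dvd_of_isCyclotomicExtension N
    hfin.orderOf_pos.ne'
  exact orderOf_dvd_iff_pow_eq_one.1 hd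

/-! ### Descent to `ℚ(ζ^p)` -/

theorem mem_adjoin_simple_of_fixed [IsGalois ℚ K] {z x : K}
    (h : ∀ τ : K ≃ₐ[ℚ] K, τ z = z → τ x = x) : x ∈ ℚ⟮z⟯ := by
  rw [← IsGalois.fixedField_fixingSubgroup ℚ⟮z⟯, IntermediateField.mem_fixedField_iff]
  intro τ hτ
  refine h τ ?_
  exact (IntermediateField.mem_fixingSubgroup_iff _ _).1 hτ _ (mem_adjoin_simple_self ℚ _)

theorem exists_dvd_add_mul_of_coprime {A m : ℕ} (h : A.Coprime m) (hm : m ≠ 0) (r : ℕ) :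
    ∃ j : ℕ, m ∣ r + A * j := by
  have : NeZero m := ⟨hm⟩
  refine ⟨(-(r : ZMod m) * (A : ZMod m)⁻¹).val, ?_⟩
  rw [← ZMod.natCast_eq_zero_iff]
  push_cast
  rw [ZMod.natCast_val, ZMod.cast_id', id, mul_left_comm, ZMod.coe_mul_inv_eq_one A h]
  ring

theorem iterate_apply_eq_pow_mul {τ : K ≃ₐ[ℚ] K} {y e : K} (hy : τ y = e * y) (he : τ e = e)
    (n : ℕ) : (τ ^ n) y = e ^ n * y := by
  induction n with
  | zero => simp
  | succ n ih => rw [pow_succ', AlgEquiv.mul_apply, ih, map_mul, map_pow, he, hy, pow_succ, mul_assoc]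

/-- Up to a root of unity, an algebraic integer all of whose archimedean absolute values are
`p ^ (k / 2)` lies in the field of level `N / p` as soon as `p ^ 2 ∣ N`. -/
theorem exists_mul_mem_adjoin_pow (hζ : IsPrimitiveRoot ζ N) {p k : ℕ} (hp : p.Prime)
    (hodd : Odd p) (hpN : p ^ 2 ∣ N) {x : K} (hx : IsIntegral ℤ x)
    (hxn : ∀ φ : K →+* ℂ, ‖φ x‖ ^ 2 = (p ^ k : ℕ)) :
    ∃ j : ℕ, ζ ^ j * x ∈ ℚ⟮ζ ^ p⟯ := by
  obtain ⟨a, M, hpM, hNM⟩ := Nat.exists_eq_pow_mul_and_not_dvd (NeZero.ne N) p hp.ne_one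
  have hpMc : p.Coprime M := (hp.coprime_iff_not_dvd).2 hpM
  have ha0 : a ≠ 0 := by
    rintro rfl
    rw [pow_zero, one_mul] at hNM
    exact hpM (hNM ▸ (dvd_pow_self p two_ne_zero).trans hpN)
  have hp2 : Nat.Coprime 2 p := (Nat.coprime_primes Nat.prime_two hp).2 
    (by rintro rfl; exact absurd hodd (by decide))
  have hx0 : x ≠ 0 := by
    rintro rfl
    obtain ⟨φ₀⟩ : Nonempty (K →+* ℂ) := inferInstance
    have := hxn φ₀
    rw [map_zero, norm_zero, zero_pow two_ne_zero] at this
    exact (pow_pos hp.pos k).ne (by exact_mod_cast this)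
  -- `1 + M * l` is `-1` modulo `p ^ a` and `1` modulo `M`; it is the exponent of `s`.
  obtain ⟨l, hl⟩ := exists_dvd_add_mul_of_coprime (hpMc.symm.pow_right a) (pow_pos hp.pos a).ne' 2
  have hpl : p ∣ 2 + M * l := (dvd_pow_self p ha0).trans hl
  have hMl : (M * l).Coprime p := by
    rw [Nat.coprime_comm, hp.coprime_iff_not_dvd]
    intro h
    exact (hp.coprime_iff_not_dvd.1 hp2.symm) ((Nat.dvd_add_left h).1 hpl)
  have hc : (1 + M * l).Coprime N := by
    rw [hNM]
    refine Nat.Coprime.mul_right (Nat.Coprime.pow_right a ?_)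
      ((Nat.coprime_add_mul_left_left 1 M l).2 (Nat.coprime_one_left M))
    rw [Nat.coprime_comm, hp.coprime_iff_not_dvd]
    intro h
    have : 2 + M * l = 1 + (1 + M * l) := by ring
    rw [this] at hpl
    exact hp.one_lt.ne' (Nat.dvd_one.1 ((Nat.dvd_add_left h).1 hpl))
  obtain ⟨s, hs⟩ := hζ.exists_algEquiv_apply_eq_pow hc
  have hs' : s ζ = ζ ^ (M * l) * ζ := by rw [hs, ← pow_succ, add_comm]
  have hω : (ζ ^ (M * l)) ^ p ^ a = 1 := by
    rw [← pow_mul, hζ.pow_eq_one_iff_dvd, hNM]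
    exact ⟨l, by ring⟩
  obtain ⟨ε, hε, hsx⟩ := exists_root_of_unity_mul_of_inertia hζ hp hω hs' hx hxn
  obtain ⟨r, -, hr⟩ := hζ.eq_pow_of_pow_eq_one (ξ := ε ^ 2) (by rw [← pow_mul, hε])
  -- Twisting by `ζ ^ j` turns `ε ^ 2 = ζ ^ r` into `ζ ^ (r + 2 * (M * l) * j)`; `j` makes this an
  -- `M`-th root of unity.
  obtain ⟨j, t, hj⟩ := exists_dvd_add_mul_of_coprime
    (Nat.Coprime.mul_left (hp2.pow_right a) (hMl.pow_right a)) (pow_pos hp.pos a).ne' r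
  have : IsGalois ℚ K := IsCyclotomicExtension.isGalois {N} ℚ K
  refine ⟨j, mem_adjoin_simple_of_fixed fun τ hτ => ?_⟩
  have hζ0 : ζ ≠ 0 := hζ.ne_zero (NeZero.ne N)
  set y := ζ ^ j * x with hy
  have hy0 : y ≠ 0 := mul_ne_zero (pow_ne_zero _ hζ0) hx0
  set u := ζ ^ (M * l * j) * ε with hu
  have hsy : s y = u * y := by
    rw [hy, hu, map_mul, map_pow, hs', hsx]
    ring
  have hu2 : u ^ 2 = (ζ ^ p) ^ (p ^ (a - 1) * t) := by
    have : p * (p ^ (a - 1) * t) = p ^ a * t := by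
      rw [← mul_assoc, ← pow_succ', Nat.sub_add_cancel (Nat.one_le_iff_ne_zero.2 ha0)]
    rw [hu, mul_pow, ← hr, ← pow_mul ζ p, this, ← hj]
    ring
  have hτu : τ (u ^ 2) = u ^ 2 := by rw [hu2, map_pow, hτ]
  have hyi : IsIntegral ℤ y := ((hζ.isIntegral (NeZero.pos N)).pow j).mul hx
  have hyn (φ : K →+* ℂ) : ‖φ y‖ ^ 2 = (p ^ k : ℕ) := by
    have h1 : ‖φ (ζ ^ j)‖ = 1 := by
      refine Complex.norm_eq_one_of_pow_eq_one (n := N) ?_ (NeZero.ne N)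
      rw [← map_pow, ← pow_mul, mul_comm, pow_mul, hζ.pow_eq_one, one_pow, map_one]
    rw [hy, map_mul, norm_mul, h1, one_mul, hxn]
  obtain ⟨ω, hωp, hτζ⟩ : ∃ ω : K, ω ^ p = 1 ∧ τ ζ = ω * ζ := by
    refine ⟨τ ζ / ζ, ?_, (div_mul_cancel₀ _ hζ0).symm⟩
    rw [div_pow, ← map_pow, hτ, div_self (pow_ne_zero _ hζ0)]
  -- Since `p ^ 2 ∣ N`, the `p`-th root of unity `ω` is a power of `ζ ^ p`.
  have hτω : τ ω = ω := by
    obtain ⟨N', hN'⟩ := hpN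
    obtain ⟨i, -, rfl⟩ := hζ.eq_pow_of_pow_eq_one (ξ := ω)
      (by rw [hN', pow_two, mul_assoc, pow_mul, hωp, one_pow])
    rw [← pow_mul, hζ.pow_eq_one_iff_dvd, hN', pow_two, mul_assoc, mul_comm i] at hωp
    obtain ⟨i', rfl⟩ := (dvd_mul_right p N').trans (Nat.dvd_of_mul_dvd_mul_left hp.pos hωp)
    rw [pow_mul, map_pow, hτ]
  have hτp : τ ^ p = 1 := by
    have h : (τ ^ p).toAlgHom = (1 : K ≃ₐ[ℚ] K).toAlgHom := by
      refine hζ.algHom_ext_of_cyclotomic ?_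
      change (τ ^ p) ζ = ζ
      rw [iterate_apply_eq_pow_mul hτζ hτω, hωp, one_mul]
    exact AlgEquiv.coe_toAlgHom_injective h
  obtain ⟨e, he, hτy⟩ := exists_root_of_unity_mul_of_inertia hζ hp (b := 1)
    (by rwa [pow_one]) hτζ hyi hyn
  have hcomm : s (τ y) = τ (s y) := by
    have h : (s * τ).toAlgHom = (τ * s).toAlgHom := by
      refine hζ.algHom_ext_of_cyclotomic ?_
      change s (τ ζ) = τ (s ζ)
      obtain ⟨i, -, hi⟩ := hζ.eq_pow_of_pow_eq_one (ξ := τ ζ)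
        (by rw [← map_pow, hζ.pow_eq_one, map_one])
      rw [← hi, hs, map_pow, map_pow, hs, ← hi]
      ring
    exact DFunLike.congr_fun h y
  -- Squares are compared because only `u ^ 2`, not `u`, is known to be fixed by `τ`.
  have hse : s (e ^ 2) = e ^ 2 := by
    rw [hτy, hsy, map_mul s e y, map_mul τ u y, hsy, hτy] at hcomm
    have hu0 : u ≠ 0 := by
      rintro h
      rw [h, zero_mul, map_eq_zero] at hsy
      exact hy0 hsy
    refine mul_right_cancel₀ (mul_ne_zero (pow_ne_zero 2 hu0) (pow_ne_zero 2 hy0)) ?_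
    calc s (e ^ 2) * (u ^ 2 * y ^ 2) = (s e * (u * y)) ^ 2 := by rw [map_pow]; ring
      _ = τ (u ^ 2) * (e * y) ^ 2 := by rw [hcomm, mul_pow, map_pow]
      _ = _ := by rw [hτu]; ring
  obtain ⟨r', -, hr'⟩ := hζ.eq_pow_of_pow_eq_one (ξ := e ^ 2) (by rw [← pow_mul, he])
  obtain ⟨r₁, rfl⟩ : p ^ a ∣ r' := by
    rw [← hr', map_pow, hs', mul_pow] at hse
    have h1 : (ζ ^ (M * l)) ^ r' = 1 :=
      mul_right_cancel₀ (pow_ne_zero r' hζ0) (by rw [hse, one_mul])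
    rw [← pow_mul, hζ.pow_eq_one_iff_dvd] at h1
    exact (hMl.pow_right a).symm.dvd_of_dvd_mul_left
      ((hNM ▸ dvd_mul_right (p ^ a) M : p ^ a ∣ N).trans h1)
  have heM : (e ^ 2) ^ M = 1 := by
    rw [← hr', ← pow_mul, hζ.pow_eq_one_iff_dvd, hNM]
    exact ⟨r₁, by ring⟩
  have hτe : τ (e ^ 2) = e ^ 2 := by
    have : p ^ a * r₁ = p * (p ^ (a - 1) * r₁) := by
      rw [← mul_assoc, ← pow_succ', Nat.sub_add_cancel (Nat.one_le_iff_ne_zero.2 ha0)]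
    rw [← hr', this, pow_mul, map_pow, hτ]
  have hep : (e ^ 2) ^ p = 1 := by
    have h := iterate_apply_eq_pow_mul (τ := τ) (y := y ^ 2) (by rw [map_pow, hτy, mul_pow]) hτe p
    rw [hτp, AlgEquiv.one_apply] at h
    exact mul_right_cancel₀ (pow_ne_zero 2 hy0) (by rw [← h, one_mul])
  -- `e ^ 2` has order dividing both `p` and `M`; the sign left over dies because `p` is odd.
  have he2 : e ^ 2 = 1 := by
    have := pow_gcd_eq_one.2 ⟨hep, heM⟩
    rwa [hpMc, pow_one] at this
  have hτe1 : τ e = e := by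
    rcases mul_self_eq_one_iff.1 (by rwa [← pow_two] : e * e = 1) with h | h <;> rw [h] <;> simp
  have hep1 : e ^ p = 1 := by
    have h := iterate_apply_eq_pow_mul hτy hτe1 p
    rw [hτp, AlgEquiv.one_apply] at h
    exact mul_right_cancel₀ hy0 (by rw [← h, one_mul])
  have he1 : e = 1 := by
    have := pow_gcd_eq_one.2 ⟨he2, hep1⟩
    rwa [hp2, pow_one] at this
  rw [hτy, he1, one_mul]

end CyclotomicField

namespace CyclotomicHouse

open NumberField IntermediateField

/-! ### Cyclotomic subfields of `ℂ` and the house -/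

theorem map_mem_adjoin_rat_simple {K L : Type*} [Field K] [CharZero K] [Field L] [CharZero L]
    (f : K →+* L) {x y : K} (hx : x ∈ ℚ⟮y⟯) : f x ∈ ℚ⟮f y⟯ := by
  have h : f.toRatAlgHom x ∈ ℚ⟮y⟯.map f.toRatAlgHom := ⟨x, hx, rfl⟩
  rwa [adjoin_map, Set.image_singleton] at h

theorem isPrimitiveRoot_zeta {N : ℕ} (hN : N ≠ 0) : IsPrimitiveRoot (zeta N) N :=
  Complex.isPrimitiveRoot_exp N hN

theorem zeta_mul_pow {m n : ℕ} (hm : m ≠ 0) : zeta (m * n) ^ m = zeta n := by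
  rw [zeta, zeta, ← Complex.exp_nat_mul]
  congr 1
  have : (m : ℂ) ≠ 0 := Nat.cast_ne_zero.2 hm
  push_cast
  rw [← mul_div_assoc, mul_div_mul_left _ _ this]

theorem IsRootOfUnity.mul {x y : ℂ} (hx : IsRootOfUnity x) (hy : IsRootOfUnity y) :
    IsRootOfUnity (x * y) := by
  obtain ⟨m, hm, hx⟩ := hx
  obtain ⟨n, hn, hy⟩ := hy
  refine ⟨m * n, Nat.mul_pos hm hn, ?_⟩
  rw [mul_pow, pow_mul, hx, one_pow, one_mul, mul_comm m, pow_mul, hy, one_pow]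

theorem adjoin_zeta_le {m n : ℕ} (hm : m ≠ 0) (h : n ∣ m) : ℚ⟮zeta n⟯ ≤ ℚ⟮zeta m⟯ := by
  obtain ⟨l, rfl⟩ := h
  rw [adjoin_simple_le_iff, mul_comm, ← zeta_mul_pow (m := l) (n := n) (right_ne_zero_of_mul hm)]
  exact pow_mem (mem_adjoin_simple_self ℚ _) l

instance isCyclotomicExtension_adjoin_zeta (N : ℕ) [NeZero N] :
    IsCyclotomicExtension {N} ℚ ℚ⟮zeta N⟯ := by
  have hζ := isPrimitiveRoot_zeta (NeZero.ne N)
  have hi : IsIntegral ℚ (zeta N) := (hζ.isIntegral (NeZero.pos N)).tower_top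
  change IsCyclotomicExtension {N} ℚ ℚ⟮zeta N⟯.toSubalgebra
  rw [adjoin_simple_toSubalgebra_of_isAlgebraic hi.isAlgebraic]
  exact hζ.adjoin_isCyclotomicExtension ℚ

instance numberField_adjoin_zeta (N : ℕ) [NeZero N] : NumberField ℚ⟮zeta N⟯ :=
  IsCyclotomicExtension.numberField {N} ℚ _

theorem IsCyclotomicInteger.isIntegral {α : ℂ} (hα : IsCyclotomicInteger α) : IsIntegral ℤ α := by
  induction hα using Subring.closure_induction with
  | mem x hx =>
    obtain ⟨n, hn, h⟩ := hx
    exact IsIntegral.of_pow hn (by rw [h]; exact isIntegral_one)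
  | zero => exact isIntegral_zero
  | one => exact isIntegral_one
  | add _ _ _ _ h₁ h₂ => exact h₁.add h₂
  | neg _ _ h => exact h.neg
  | mul _ _ _ _ h₁ h₂ => exact h₁.mul h₂

theorem IsCyclotomicInteger.exists_mem_adjoin_zeta {α : ℂ} (hα : IsCyclotomicInteger α) :
    ∃ N : ℕ, N ≠ 0 ∧ α ∈ ℚ⟮zeta N⟯ := by
  have common {x y : ℂ} (hx : ∃ N : ℕ, N ≠ 0 ∧ x ∈ ℚ⟮zeta N⟯)
      (hy : ∃ N : ℕ, N ≠ 0 ∧ y ∈ ℚ⟮zeta N⟯) :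
      ∃ N : ℕ, N ≠ 0 ∧ x ∈ ℚ⟮zeta N⟯ ∧ y ∈ ℚ⟮zeta N⟯ := by
    obtain ⟨m, hm, hx⟩ := hx
    obtain ⟨n, hn, hy⟩ := hy
    exact ⟨m * n, mul_ne_zero hm hn, adjoin_zeta_le (mul_ne_zero hm hn) (dvd_mul_right m n) hx,
      adjoin_zeta_le (mul_ne_zero hm hn) (dvd_mul_left n m) hy⟩
  induction hα using Subring.closure_induction with
  | mem x hx =>
    obtain ⟨n, hn, h⟩ := hx
    have : NeZero n := ⟨hn.ne'⟩
    obtain ⟨i, -, rfl⟩ := (isPrimitiveRoot_zeta hn.ne').eq_pow_of_pow_eq_one h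
    exact ⟨n, hn.ne', pow_mem (mem_adjoin_simple_self ℚ _) i⟩
  | zero => exact ⟨1, one_ne_zero, zero_mem _⟩
  | one => exact ⟨1, one_ne_zero, one_mem _⟩
  | add _ _ _ _ h₁ h₂ =>
    obtain ⟨N, hN, hx, hy⟩ := common h₁ h₂
    exact ⟨N, hN, add_mem hx hy⟩
  | neg _ _ h =>
    obtain ⟨N, hN, h⟩ := h
    exact ⟨N, hN, neg_mem h⟩
  | mul _ _ _ _ h₁ h₂ =>
    obtain ⟨N, hN, hx, hy⟩ := common h₁ h₂
    exact ⟨N, hN, mul_mem hx hy⟩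

/-- If the square of the house of a cyclotomic integer is a natural number, then all conjugates
have the same absolute value. -/
theorem norm_sq_eq_of_isConjRoot {α γ : ℂ} (hα : IsCyclotomicInteger α) {q : ℕ}
    (hq : house α ^ 2 = q) (hγ : IsConjRoot ℚ α γ) : ‖γ‖ ^ 2 = q := by
  obtain ⟨N, hN, hαN⟩ := hα.exists_mem_adjoin_zeta
  have : NeZero N := ⟨hN⟩
  have hαi : IsIntegral ℚ α := hα.isIntegral.tower_top
  let x : ℚ⟮zeta N⟯ := ⟨α, hαN⟩
  have hx : minpoly ℚ x = minpoly ℚ α := (minpoly.algebraMap_eq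
    (algebraMap ℚ⟮zeta N⟯ ℂ).injective x).symm
  have hrange : Set.range (fun φ : ℚ⟮zeta N⟯ →+* ℂ => φ x) = (minpoly ℚ α).rootSet ℂ := by
    rw [Embeddings.range_eval_eq_rootSet_minpoly, hx]
  obtain ⟨γ₀, hγ₀, hh⟩ := (isGreatest_house hαi).1
  obtain ⟨φ₀, rfl⟩ := hrange ▸ hγ₀
  obtain ⟨φ, rfl⟩ := hrange ▸ (isConjRoot_iff_mem_minpoly_rootSet hαi).1 hγ
  exact norm_sq_embedding_eq N (φ := φ₀) (by rw [← hq, ← hh]) φ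

end CyclotomicHouse

/-! ### Contradiction with minimality of the level -/

open CyclotomicHouse IntermediateField in
theorem lemma6p6 (p : ℕ) (hp : p.Prime) (hodd : Odd p) (α : ℂ)
    (hα : CyclotomicHouse.IsCyclotomicInteger α)
    (hpow : ∃ k : ℕ, CyclotomicHouse.house α ^ 2 = (p : ℝ) ^ k) :
    ¬ p ^ 2 ∣ CyclotomicHouse.minimalLevel α := by
  intro hdvd
  obtain ⟨k, hk⟩ := hpow
  have hne : {N : ℕ | 0 < N ∧ ∃ β ∈ ℚ⟮zeta N⟯, Equivalent α β}.Nonempty := by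
    obtain ⟨N, hN, hαN⟩ := hα.exists_mem_adjoin_zeta
    exact ⟨N, Nat.pos_of_ne_zero hN, α, hαN, 1, α, ⟨1, one_pos, one_pow 1⟩, IsConjRoot.refl,
      (one_mul α).symm⟩
  obtain ⟨hN, β, hβN, ξ, γ, hξ, hγ, hβ⟩ := Nat.sInf_mem hne
  change p ^ 2 ∣ sInf {N : ℕ | 0 < N ∧ ∃ β ∈ ℚ⟮zeta N⟯, Equivalent α β} at hdvd
  have hmin {m : ℕ} (hm : m ∈ {N : ℕ | 0 < N ∧ ∃ β ∈ ℚ⟮zeta N⟯, Equivalent α β}) :=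
    Nat.sInf_le hm
  generalize sInf {N : ℕ | 0 < N ∧ ∃ β ∈ ℚ⟮zeta N⟯, Equivalent α β} = N at *
  have : NeZero N := ⟨hN.ne'⟩
  obtain ⟨M, rfl⟩ := (dvd_pow_self p two_ne_zero).trans hdvd
  have hγn : ‖γ‖ ^ 2 = (p ^ k : ℕ) :=
    norm_sq_eq_of_isConjRoot hα (by rw [hk, Nat.cast_pow]) hγ
  -- A monic integer polynomial killing `α` is divisible by the shared minimal polynomial.
  have hγi : IsIntegral ℤ γ := by
    obtain ⟨f, hf, hf0⟩ := hα.isIntegral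
    refine ⟨f, hf, ?_⟩
    have hd : minpoly ℚ α ∣ f.map (algebraMap ℤ ℚ) := minpoly.dvd ℚ α (by
      rw [Polynomial.aeval_map_algebraMap]
      exact hf0)
    rw [hγ] at hd
    have := Polynomial.aeval_eq_zero_of_dvd_aeval_eq_zero hd (minpoly.aeval ℚ γ)
    rwa [Polynomial.aeval_map_algebraMap] at this
  have hξ' := hξ
  obtain ⟨n, hn, hξn⟩ := hξ'
  have hξ1 : ‖ξ‖ = 1 := Complex.norm_eq_one_of_pow_eq_one hξn hn.ne'
  have hβi : IsIntegral ℤ β := by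
    rw [hβ]
    exact (IsIntegral.of_pow hn (by rw [hξn]; exact isIntegral_one)).mul hγi
  have hβn : ‖β‖ ^ 2 = (p ^ k : ℕ) := by rw [hβ, norm_mul, hξ1, one_mul, hγn]
  let K := ℚ⟮zeta (p * M)⟯
  let z : K := ⟨zeta (p * M), mem_adjoin_simple_self ℚ _⟩
  let x : K := ⟨β, hβN⟩
  have hz : IsPrimitiveRoot z (p * M) :=
    IsPrimitiveRoot.of_map_of_injective (f := algebraMap K ℂ)
      (isPrimitiveRoot_zeta hN.ne') (algebraMap K ℂ).injective
  have hxi : IsIntegral ℤ x := (isIntegral_algHom_iff (algebraMap K ℂ).toIntAlgHom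
    (algebraMap K ℂ).injective).1 hβi
  obtain ⟨j, hj⟩ := exists_mul_mem_adjoin_pow hz hp hodd hdvd hxi
    (norm_sq_embedding_eq (p * M) (φ := algebraMap K ℂ) hβn)
  have hmem : zeta (p * M) ^ j * β ∈ ℚ⟮zeta M⟯ := by
    have h := map_mem_adjoin_rat_simple (algebraMap K ℂ) hj
    have hzp : algebraMap K ℂ (z ^ p) = zeta M := zeta_mul_pow hp.ne_zero
    rw [hzp] at h
    exact h
  have hM : 0 < M := Nat.pos_of_mul_pos_left hN
  have hle := hmin (m := M) ⟨hM, _, hmem, zeta (p * M) ^ j * ξ, γ,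
    IsRootOfUnity.mul ⟨p * M, hN, by
      rw [← pow_mul, mul_comm j, pow_mul, (isPrimitiveRoot_zeta hN.ne').pow_eq_one, one_pow]⟩ hξ,
    hγ, by rw [hβ, mul_assoc]⟩
  exact absurd hle (not_le.2 (lt_mul_of_one_lt_left hM hp.one_lt))
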